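/- **Theorem 3.2 (First order Floquet matrix and Lyapunov's transformation).** Let $T>0$, $r_0>0$, $N\in\mathbb{N}$, and for complex $\epsilon$ with $|\epsilon|<r_0$ let $$A_\epsilon(t)=A_0+\epsilon A_1(t)+\epsilon^2A_2(t)+\dots\in\mathbb{C}^{N\times N}$$ be continuous and $T$-periodic in $t\in\mathbb{R}$, where for each $\epsilon$ with $|\epsilon|<r_0$ the series converges uniformly in $t$, $A_0$ is constant and diagonal, and every $A_j$, $j\ge1$, has a finite Fourier series $A_j(t)=\sum_{m\in\mathbb{Z}}e^{\frac{2\pi i}{T}mt}A_j^m$ (only finitely many $A_j^m\in\mathbb{C}^{N\times N}$ are nonzero). Let $F_0$ be the diagonal matrix with $\operatorname{Im}(F_0)_{kk}\in(-\frac{\pi}{T},\frac{\pi}{T}]$ for which the folding numbers $$n_k=\frac{T}{2\pi i}(A_0-F_0)_{kk}$$ are integers, $k=1,\dots,N$. By an analytic Floquet–Lyapunov decomposition of $dx/dt=A_\epsilon(t)x$ we mean matrices $F_\epsilon=F_0+\epsilon F_1+\epsilon^2F_2+\dots$ and functions $P_\epsilon(t)=P_0(t)+\epsilon P_1(t)+\epsilon^2P_2(t)+\dots$,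 both series convergent for all $t\in\mathbb{R}$ and all $\epsilon$ in some disc around $0$ that does not depend on $t$, such that for these $\epsilon$ the function $P_\epsilon$ is $T$-periodic and $X_\epsilon(t)=P_\epsilon(t)\exp(F_\epsilon t)$ is the fundamental solution, i.e. $\frac{dX_\epsilon}{dt}=A_\epsilon(t)X_\epsilon$ and $X_\epsilon(0)=\mathrm{Id}$. Then there is an analytic Floquet–Lyapunov decomposition whose leading coefficient is the above $F_0$, and every such decomposition satisfies, for all $k,l\in\{1,\dots,N\}$ and $t\in\mathbb{R}$, $$(F_1)_{kl}=\begin{cases}(A_1^{n_k-n_l})_{kl}&\text{if }(F_0)_{kk}=(F_0)_{ll},\\[4pt]\displaystyle\big((F_0)_{ll}-(F_0)_{kk}\big)\sum_{m\in\mathbb{Z}}\frac{(A_1^m)_{kl}}{\frac{2\pi i}{T}m+(A_0)_{ll}-(A_0)_{kk}}&\text{if }(F_0)_{kk}\ne(F_0)_{ll},\end{cases}$$ and $$(P_1(t))_{kl}=\sum_{m\in\mathbb{Z}}e^{\frac{2\pi i}{T}mt}\begin{cases}\displaystyle\frac{(A_1^{m-n_l})_{kl}}{\frac{2\pi i}{T}m-(A_0)_{kk}+(F_0)_{ll}}&\text{if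 }m\ne n_k,\\[8pt]\displaystyle-\sum_{\tilde m\ne n_k}\frac{(A_1^{\tilde m-n_l})_{kl}}{\frac{2\pi i}{T}\tilde m-(A_0)_{kk}+(F_0)_{ll}}&\text{if }m=n_k.\end{cases}$$ In particular, the diagonal of $F_1$ is that of the mean of $A_1$: $$(F_1)_{kk}=(A_1^0)_{kk}=\frac1T\int_0^T(A_1(t))_{kk}\,dt.$$ -/

import Mathlib

noncomputable section

/-- `X` is the fundamental solution of `dx/dt = A(t) x`: `X(0) = Id` and `X' = A X`
(the derivative is taken entry by entry). -/
def IsFundamentalSolution {N : ℕ} (A X : ℝ → Matrix (Fin N) (Fin N) ℂ) : Prop :=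
  X 0 = 1 ∧ ∀ (t : ℝ) (k l : Fin N), HasDerivAt (fun s => X s k l) ((A t * X t) k l) t

/-- `(P, F)` is a Floquet-Lyapunov decomposition of `dx/dt = A(t) x`: the function `P` is
`T`-periodic and `t ↦ P(t) exp(F t)` is the fundamental solution. -/
structure IsFloquetDecomposition {N : ℕ} (T : ℝ) (A : ℝ → Matrix (Fin N) (Fin N) ℂ)
    (F : Matrix (Fin N) (Fin N) ℂ) (P : ℝ → Matrix (Fin N) (Fin N) ℂ) : Prop where
  periodic : Function.Periodic P T
  fundamental : IsFundamentalSolution A (fun t => P t * NormedSpace.exp ((t : ℂ) • F))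

/-- The pairs `(P ε, F ε)` form a Floquet-Lyapunov decomposition of `dx/dt = A_ε(t) x` that depends
analytically on `ε` near `0`, with expansions `F_ε = ∑ ε ^ j F_j` and `P_ε(t) = ∑ ε ^ j P_j(t)`,
where `F_j` is `Fc j` and `P_j` is `Pc j`. -/
def IsAnalyticFloquetDecomposition {N : ℕ} (T : ℝ) (A : ℂ → ℝ → Matrix (Fin N) (Fin N) ℂ)
    (F : ℂ → Matrix (Fin N) (Fin N) ℂ) (P : ℂ → ℝ → Matrix (Fin N) (Fin N) ℂ)
    (Fc : ℕ → Matrix (Fin N) (Fin N) ℂ) (Pc : ℕ → ℝ → Matrix (Fin N) (Fin N) ℂ) : Prop :=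
  ∃ r : ℝ, 0 < r ∧ ∀ ε : ℂ, ‖ε‖ < r →
    IsFloquetDecomposition T (A ε) (F ε) (P ε) ∧
    HasSum (fun j : ℕ => ε ^ j • Fc j) (F ε) ∧
    ∀ t : ℝ, HasSum (fun j : ℕ => ε ^ j • Pc j t) (P ε t)

/-- The function `t ↦ ∑ m, exp(2πi m t / T) c_m`, a finite Fourier series of period `T` with matrix
coefficients `c_m`. -/
def finiteFourierSeries {N : ℕ} (T : ℝ) (c : ℤ →₀ Matrix (Fin N) (Fin N) ℂ) (t : ℝ) :
    Matrix (Fin N) (Fin N) ℂ :=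
  c.sum fun m M => Complex.exp (2 * Real.pi * Complex.I / T * m * t) • M

/-- `A_ε(t) = A_0 + ε A_1(t) + ε² A_2(t) + …` is a continuous `T`-periodic family, analytic in `ε`
for `‖ε‖ < r₀`; `A_0` is constant and diagonal, and for `j ≥ 1` the coefficient `A_j` is the finite
Fourier series with coefficients `A_j^m`, which are `c j m`. The power series converges for
`‖ε‖ < r₀`, uniformly in `t`. -/
structure IsAnalyticPeriodicFamily {N : ℕ} (T r₀ : ℝ) (A : ℂ → ℝ → Matrix (Fin N) (Fin N) ℂ)
    (A₀ : Matrix (Fin N) (Fin N) ℂ) (Ac : ℕ → ℝ → Matrix (Fin N) (Fin N) ℂ)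
    (c : ℕ → ℤ →₀ Matrix (Fin N) (Fin N) ℂ) : Prop where
  continuous : ∀ ε : ℂ, ‖ε‖ < r₀ → Continuous (A ε)
  periodic : ∀ ε : ℂ, ‖ε‖ < r₀ → Function.Periodic (A ε) T
  coeff_zero : ∀ t : ℝ, Ac 0 t = A₀
  diagonal : A₀.IsDiag
  coeff_fourier : ∀ j : ℕ, 1 ≤ j → ∀ t : ℝ, Ac j t = finiteFourierSeries T (c j) t
  expansion : ∀ ε : ℂ, ‖ε‖ < r₀ → ∀ k l : Fin N,
    TendstoUniformly (fun (n : ℕ) (t : ℝ) => (∑ j ∈ Finset.range n, ε ^ j • Ac j t) k l)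
      (fun t => A ε t k l) Filter.atTop

/-- `F₀` is the leading order exponent matrix belonging to the diagonal matrix `A₀`, with folding
numbers `n`: it is diagonal, the imaginary parts of its diagonal entries lie in `(-π/T, π/T]`, and
`n_k = T (A₀ - F₀)_{kk} / (2πi)` is an integer for every `k`. -/
structure IsLeadingExponent {N : ℕ} (T : ℝ) (A₀ F₀ : Matrix (Fin N) (Fin N) ℂ)
    (n : Fin N → ℤ) : Prop where
  diagonal : F₀.IsDiag
  im_mem : ∀ k : Fin N, (F₀ k k).im ∈ Set.Ioc (-(Real.pi / T)) (Real.pi / T)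
  folding : ∀ k : Fin N, (n k : ℂ) = T / (2 * Real.pi * Complex.I) * (A₀ - F₀) k k

end

/-! ### Power series in `ε` and the quadratic fixed-point equation. -/

noncomputable section
open Filter Topology Asymptotics

/-! Let D(t) = diag(exp(2πi n_k t/T)) and write P = D Q, F = F₀ + G. Because A₀ = F₀ + (2πi/T)
diag(n), the equation P' = A P - P F turns into Q' = F₀ Q - Q F₀ + B Q - Q G with Q(0) = 1, where B
= D⁻¹(A_ε - A₀)D is periodic and vanishes at ε = 0. Put h = B Q - (Q - 1) G. Entry by entry, Q - 1
solves q' = λ q + h - g, q(0) = 0, where λ is a difference of diagonal entries of F₀. The strip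
condition on F₀ keeps λ away from the nonzero multiples of 2πi/T, so exactly one constant g admits a
periodic solution, and that solution is unique (`eq_periodicSol`).

Hence G = g(h) and Q - 1 = R(h) for bounded operators g, R on continuous functions on the circle,
and a Floquet decomposition is the same as a solution of h = B(1 + R h) - (R h)(g h)
(`isFloquetDecomposition_iff_reduced`).

Existence is the implicit function theorem (`exists_solution_quadratic`). Conversely, for a given
analytic decomposition G tends to 0, and the equation itself forces h = ε B₁ + o(ε)
(`hasDerivAt_solution_quadratic`). So F₁ = g(B₁) and P₁ = D R(B₁) (`first_order_eq`); the formulas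
follow by evaluating g and R on exponentials (`periodic_circleExp`). -/

theorem hasFPowerSeriesAt_of_tendsto_partialSum {E : Type*} [NormedAddCommGroup E] [NormedSpace ℂ E]
    [CompleteSpace E] {a : ℕ → E} {f : ℂ → E} {r : ℝ} (hr : 0 < r)
    (h : ∀ ε : ℂ, ‖ε‖ < r →
      Tendsto (fun n => ∑ j ∈ Finset.range n, ε ^ j • a j) atTop (𝓝 (f ε))) :
    HasFPowerSeriesAt f (fun j => ContinuousMultilinearMap.mkPiRing ℂ (Fin j) (a j)) 0 := by
  set p : FormalMultilinearSeries ℂ ℂ E :=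
    fun j => ContinuousMultilinearMap.mkPiRing ℂ (Fin j) (a j) with hp
  have hρ : 0 < r / 2 := by positivity
  obtain ⟨ρ, hρc⟩ : ∃ ρ : NNReal, (ρ : ℝ) = r / 2 := ⟨⟨r / 2, hρ.le⟩, rfl⟩
  -- Ordered convergence at the single point r/2 already makes the terms tend to zero, which bounds
  -- the radius from below; absolute convergence is not assumed.
  have hterm : Tendsto (fun n => ((r / 2 : ℝ) : ℂ) ^ n • a n) atTop (𝓝 0) := by
    have h1 := h ((r / 2 : ℝ) : ℂ) (by
      rw [Complex.norm_real, Real.norm_of_nonneg hρ.le]; linarith)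
    have h2 := (h1.comp (tendsto_add_atTop_nat 1)).sub h1
    simpa [Finset.sum_range_succ, Function.comp_def] using h2
  have hrad : (ρ : ENNReal) ≤ p.radius := by
    refine p.le_radius_of_tendsto (l := 0) ?_
    have := hterm.norm
    simp only [norm_smul, norm_pow, Complex.norm_real, Real.norm_of_nonneg hρ.le, norm_zero] at this
    refine this.congr fun n => ?_
    simp [hp, hρc, ContinuousMultilinearMap.norm_mkPiRing, mul_comm]
  have hpos : 0 < p.radius :=
    lt_of_lt_of_le (ENNReal.coe_pos.mpr (by rw [← NNReal.coe_pos, hρc]; exact hρ)) hrad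
  have hs := (p.hasFPowerSeriesOnBall hpos).hasFPowerSeriesAt
  refine hs.congr ?_
  have hball : Metric.ball (0 : ℂ) (r / 2) ∈ 𝓝 (0 : ℂ) := Metric.ball_mem_nhds _ hρ
  filter_upwards [hball] with ε hε
  have hε' : ‖ε‖ < r / 2 := by simpa using hε
  have h3 : HasSum (fun n => p n fun _ => ε) (p.sum ε) := by
    refine p.hasSum (lt_of_lt_of_le ?_ hrad |> fun h => by simpa [Metric.mem_eball] using h)
    rw [enorm_eq_nnnorm, ENNReal.coe_lt_coe, ← NNReal.coe_lt_coe, hρc]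
    exact hε'
  have h4 := h3.tendsto_sum_nat
  simp only [hp, ContinuousMultilinearMap.mkPiRing_apply, Finset.prod_const, Finset.card_univ,
    Fintype.card_fin] at h4
  exact tendsto_nhds_unique h4 (h ε (by linarith))

theorem HasFPowerSeriesAt.hasDerivAt_mkPiRing {E : Type*} [NormedAddCommGroup E] [NormedSpace ℂ E]
    {a : ℕ → E} {f : ℂ → E}
    (h : HasFPowerSeriesAt f (fun j => ContinuousMultilinearMap.mkPiRing ℂ (Fin j) (a j)) 0) :
    HasDerivAt f (a 1) 0 := by
  simpa using h.hasDerivAt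

section Quadratic
variable {E : Type*} [NormedRing E] [NormedAlgebra ℂ E]

/-- The holomorphic family `h(ε)` solving `h = B(ε) (1 + R h) - (R h) (S h)` near `ε = 0`. -/
theorem exists_solution_quadratic [CompleteSpace E] (R S : E →L[ℂ] E) {B : ℂ → E}
    (hB : AnalyticAt ℂ B 0) (hB0 : B 0 = 0) :
    ∃ h : ℂ → E, h 0 = 0 ∧ (∀ᶠ ε in 𝓝 (0 : ℂ), DifferentiableAt ℂ h ε) ∧
      ∀ᶠ ε in 𝓝 (0 : ℂ), h ε = B ε * (1 + R (h ε)) - R (h ε) * S (h ε) := by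
  set f : ℂ × E → E := fun p => p.2 - (B p.1 * (1 + R p.2) - R p.2 * S p.2) with hf
  have hBc : ContDiffAt ℂ 1 B 0 := hB.contDiffAt
  have hfst : ContDiffAt ℂ 1 (fun p : ℂ × E => B p.1) ((0 : ℂ), (0 : E)) :=
    ContDiffAt.comp ((0 : ℂ), (0 : E)) hBc contDiffAt_fst
  have hR : ContDiffAt ℂ 1 (fun p : ℂ × E => R p.2) ((0 : ℂ), (0 : E)) :=
    (R.contDiff.comp contDiff_snd).contDiffAt
  have hS : ContDiffAt ℂ 1 (fun p : ℂ × E => S p.2) ((0 : ℂ), (0 : E)) :=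
    (S.contDiff.comp contDiff_snd).contDiffAt
  have cdf : ContDiffAt ℂ 1 f ((0 : ℂ), (0 : E)) :=
    contDiffAt_snd.sub ((hfst.mul (contDiffAt_const.add hR)).sub (hR.mul hS))
  -- In the `E` direction the derivative at the origin is the identity: `B 0 = 0` removes the linear
  -- term and R y · S y is quadratic.
  have hder : fderiv ℂ f ((0 : ℂ), (0 : E)) ∘L .inr ℂ ℂ E = ContinuousLinearMap.id ℂ E := by
    have h1 : HasFDerivAt f (fderiv ℂ f ((0 : ℂ), (0 : E))) ((0 : ℂ), (0 : E)) :=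
      (cdf.differentiableAt one_ne_zero).hasFDerivAt
    have h2 : HasFDerivAt (fun y : E => ((0 : ℂ), y)) (ContinuousLinearMap.inr ℂ ℂ E) 0 :=
      hasFDerivAt_prodMk_right 0 0
    have h3 := HasFDerivAt.comp (0 : E) h1 h2
    have hR0 : HasFDerivAt (fun y : E => R y) R 0 := R.hasFDerivAt
    have hS0 : HasFDerivAt (fun y : E => S y) S 0 := S.hasFDerivAt
    have h4 : HasFDerivAt (fun y : E => y + R y * S y) (ContinuousLinearMap.id ℂ E) 0 := by
      have := (hasFDerivAt_id (𝕜 := ℂ) (0 : E)).add (hR0.mul' hS0)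
      have e : ContinuousLinearMap.id ℂ E + (R 0 • S + MulOpposite.op (S 0) • R) =
          ContinuousLinearMap.id ℂ E := by ext y; simp
      rw [e] at this
      exact this
    have h5 : f ∘ (fun y : E => ((0 : ℂ), y)) = fun y : E => y + R y * S y := by
      funext y; simp [hf, hB0]
    rw [h5] at h3
    exact h3.unique h4
  have hinv : (fderiv ℂ f ((0 : ℂ), (0 : E)) ∘L .inr ℂ ℂ E).IsInvertible := by
    rw [hder]; exact ⟨ContinuousLinearEquiv.refl ℂ E, rfl⟩
  refine ⟨cdf.implicitFunction one_ne_zero hinv,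
    cdf.implicitFunction_apply_self one_ne_zero hinv, ?_, ?_⟩
  · have := (cdf.contDiffAt_implicitFunction one_ne_zero hinv).eventually (by simp)
    exact this.mono fun x hx => hx.differentiableAt one_ne_zero
  · filter_upwards [cdf.eventually_apply_implicitFunction one_ne_zero hinv] with ε hε
    have h0 : f ((0 : ℂ), (0 : E)) = 0 := by simp [hf, hB0]
    rw [h0] at hε
    exact sub_eq_zero.mp hε

/-- If `h = B (1 + R h) - (R h) G` where `B` vanishes at `0` and `G` tends to `0`, then `h` and `B`
agree to first order. -/
theorem hasDerivAt_solution_quadratic (R : E →L[ℂ] E) {B h G : ℂ → E} {b : E}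
    (hB : HasDerivAt B b 0) (hB0 : B 0 = 0) (hG : Tendsto G (𝓝 0) (𝓝 0)) (hG0 : G 0 = 0)
    (hh : ∀ᶠ ε in 𝓝 (0 : ℂ), h ε = B ε * (1 + R (h ε)) - R (h ε) * G ε) :
    h 0 = 0 ∧ HasDerivAt h b 0 := by
  have h0 : h 0 = 0 := by
    have := hh.self_of_nhds
    simpa [hB0, hG0] using this
  have hBt : Tendsto B (𝓝 0) (𝓝 0) := by simpa [hB0] using hB.continuousAt.tendsto
  have hBO : B =O[𝓝 0] fun ε : ℂ => ε := by
    have := hB.isBigO_sub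
    simpa [hB0] using this
  -- The bound 1/2 lets the `h` terms be absorbed, giving ‖h‖ ≤ 2‖B‖. This a priori estimate
  -- replaces any continuity assumption on `h`.
  have hsmall : ∀ᶠ ε in 𝓝 (0 : ℂ), ‖R‖ * ‖B ε‖ + ‖R‖ * ‖G ε‖ < 1 / 2 := by
    have : Tendsto (fun ε => ‖R‖ * ‖B ε‖ + ‖R‖ * ‖G ε‖) (𝓝 0) (𝓝 0) := by
      simpa using (hBt.norm.const_mul ‖R‖).add (hG.norm.const_mul ‖R‖)
    exact this.eventually_lt_const (by norm_num)
  have hRG : ∀ ε, h ε - B ε = B ε * R (h ε) - R (h ε) * G ε →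
      ‖h ε - B ε‖ ≤ (‖R‖ * ‖B ε‖ + ‖R‖ * ‖G ε‖) * ‖h ε‖ := fun ε hε => by
    rw [hε]
    have e1 := R.le_opNorm (h ε)
    calc ‖B ε * R (h ε) - R (h ε) * G ε‖ ≤ ‖B ε‖ * ‖R (h ε)‖ + ‖R (h ε)‖ * ‖G ε‖ :=
          (norm_sub_le _ _).trans (add_le_add (norm_mul_le _ _) (norm_mul_le _ _))
      _ ≤ ‖B ε‖ * (‖R‖ * ‖h ε‖) + (‖R‖ * ‖h ε‖) * ‖G ε‖ := by gcongr
      _ = _ := by ring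
  have heq : ∀ᶠ ε in 𝓝 (0 : ℂ), h ε - B ε = B ε * R (h ε) - R (h ε) * G ε := by
    filter_upwards [hh] with ε hε
    rw [sub_eq_iff_eq_add]; nth_rewrite 1 [hε]; rw [mul_add, mul_one]; abel
  have hhO : h =O[𝓝 0] B := by
    refine IsBigO.of_bound 2 ?_
    filter_upwards [heq, hsmall] with ε hε hs
    have e1 := hRG ε hε
    have e2 : ‖h ε‖ ≤ ‖h ε - B ε‖ + ‖B ε‖ := by
      simpa using norm_add_le (h ε - B ε) (B ε)
    nlinarith [norm_nonneg (h ε)]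
  have hco : (fun ε => h ε - B ε) =o[𝓝 0] fun ε : ℂ => ε := by
    have hBh : (fun ε => h ε - B ε) =o[𝓝 0] h := by
      rw [isLittleO_iff]
      intro c hc
      have ht : Tendsto (fun ε => ‖R‖ * ‖B ε‖ + ‖R‖ * ‖G ε‖) (𝓝 0) (𝓝 0) := by
        simpa using (hBt.norm.const_mul ‖R‖).add (hG.norm.const_mul ‖R‖)
      filter_upwards [heq, ht.eventually_lt_const hc] with ε hε hs
      exact (hRG ε hε).trans (by gcongr)
    exact hBh.trans_isBigO (hhO.trans hBO)
  refine ⟨h0, ?_⟩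
  have hd : HasDerivAt (fun ε => h ε - B ε) 0 0 := by
    rw [hasDerivAt_iff_isLittleO]
    simpa [h0, hB0] using hco
  have e : (fun ε => h ε - B ε) + B = h := by ext ε; simp
  simpa [e] using hd.add hB

end Quadratic

theorem hasSum_pow_smul_taylor {E : Type*} [NormedAddCommGroup E] [NormedSpace ℂ E]
    [CompleteSpace E] {f : ℂ → E} {r : ℝ}
    (hf : DifferentiableOn ℂ f (Metric.ball 0 r)) {ε : ℂ} (hε : ‖ε‖ < r) :
    HasSum (fun j : ℕ => ε ^ j • ((j.factorial : ℂ)⁻¹ • iteratedDeriv j f 0)) (f ε) := by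
  have := Complex.hasSum_taylorSeries_on_ball (z := ε) hf (by simpa using hε)
  simpa [smul_comm (_ ^ _ : ℂ)] using this

end

/-! ### The scalar periodic problem q' = λ q + h - g, q(0) = 0. -/

noncomputable section
open Filter Topology MeasureTheory intervalIntegral Complex

/-- The weight `∫₀ᵀ exp(-λ s) ds`. -/
def expWeight (T : ℝ) (lam : ℂ) : ℂ := ∫ s in (0 : ℝ)..T, exp (-lam * s)

/-- For λ = 0 the integral is T; otherwise it is (exp(-λT) - 1)/(-λ), which vanishes only on nonzero
multiples of 2πi/T. -/
theorem expWeight_ne_zero {T : ℝ} (hT : 0 < T) {lam : ℂ}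
    (h : ∀ m : ℤ, lam = 2 * Real.pi * I / T * m → m = 0) : expWeight T lam ≠ 0 := by
  have hTc : (T : ℂ) ≠ 0 := by exact_mod_cast hT.ne'
  unfold expWeight
  by_cases hl : lam = 0
  · simpa [hl] using hT.ne'
  · rw [integral_exp_mul_complex (neg_ne_zero.mpr hl)]
    intro h0
    rw [div_eq_zero_iff] at h0
    rcases h0 with h0 | h0
    · have h1 : exp (-lam * T) = 1 := by simpa [sub_eq_zero] using h0
      obtain ⟨m, hm⟩ := Complex.exp_eq_one_iff.mp h1
      have h2 : lam = 2 * Real.pi * I / T * ((-m : ℤ) : ℂ) := by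
        field_simp
        push_cast
        linear_combination -hm
      have h3 := h (-m) h2
      rw [h3] at h2
      exact hl (by simpa using h2)
    · exact hl (neg_eq_zero.mp h0)

theorem norm_exp_mul_ofReal_le {T : ℝ} (lam : ℂ) {s : ℝ} (hs : s ∈ Set.Icc 0 T) :
    ‖exp (lam * s)‖ ≤ Real.exp (‖lam‖ * T) := by
  rw [Complex.norm_exp, Real.exp_le_exp]
  calc (lam * s).re ≤ ‖lam * s‖ := Complex.re_le_norm _
    _ = ‖lam‖ * s := by rw [norm_mul, Complex.norm_real, Real.norm_of_nonneg hs.1]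
    _ ≤ ‖lam‖ * T := by gcongr; exact hs.2

section Periodic
variable {T : ℝ}

theorem continuous_comp_coe (h : C(AddCircle T, ℂ)) : Continuous fun s : ℝ => h (s : AddCircle T) :=
  h.continuous.comp (AddCircle.continuous_mk' T)

theorem continuous_exp_mul_sub (lam : ℂ) (h : C(AddCircle T, ℂ)) (g : ℂ) :
    Continuous fun s : ℝ => exp (-lam * s) * (h (s : AddCircle T) - g) := by
  have := continuous_comp_coe h
  fun_prop

theorem norm_integral_exp_mul_le (lam : ℂ) {h : ℝ → ℂ} {C t : ℝ} (ht : t ∈ Set.Icc 0 T)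
    (hC : ∀ s, ‖h s‖ ≤ C) :
    ‖∫ s in (0 : ℝ)..t, exp (-lam * s) * h s‖ ≤ Real.exp (‖lam‖ * T) * C * T := by
  have hC0 : 0 ≤ C := (norm_nonneg _).trans (hC 0)
  refine (intervalIntegral.norm_integral_le_of_norm_le_const (C := Real.exp (‖lam‖ * T) * C)
    fun s hs => ?_).trans ?_
  · rw [Set.uIoc_of_le ht.1] at hs
    rw [norm_mul]
    have := norm_exp_mul_ofReal_le (T := T) (-lam) (s := s) ⟨hs.1.le, hs.2.trans ht.2⟩
    rw [norm_neg] at this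
    exact mul_le_mul this (hC s) (norm_nonneg _) (Real.exp_nonneg _)
  · rw [sub_zero, abs_of_nonneg ht.1]
    gcongr
    exact ht.2

/-- A continuous `T`-periodic function as a function on the circle. -/
def circleLift (f : ℝ → ℂ) (hf : Continuous f) (hp : Function.Periodic f T) : C(AddCircle T, ℂ) :=
  ⟨hp.lift, continuous_coinduced_dom.mpr hf⟩

theorem integral_exp_mul_sub_const (lam : ℂ) (h : C(AddCircle T, ℂ)) (g : ℂ) :
    ∫ s in (0 : ℝ)..T, exp (-lam * s) * (h (s : AddCircle T) - g) =
      (∫ s in (0 : ℝ)..T, exp (-lam * s) * h (s : AddCircle T)) - expWeight T lam * g := by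
  have hh := continuous_comp_coe h
  simp only [mul_sub]
  rw [intervalIntegral.integral_sub, intervalIntegral.integral_mul_const]
  · rfl
  · exact Continuous.intervalIntegrable (by fun_prop) _ _
  · exact Continuous.intervalIntegrable (by fun_prop) _ _

variable [hT : Fact (0 < T)]

/-- The constant `g` for which `q' = λ q + h - g`, `q(0) = 0` has a `T`-periodic solution. -/
def periodicConst (T : ℝ) [hT : Fact (0 < T)] (lam : ℂ) : C(AddCircle T, ℂ) →L[ℂ] ℂ :=
  LinearMap.mkContinuous
    { toFun := fun h => (expWeight T lam)⁻¹ * ∫ s in (0 : ℝ)..T, exp (-lam * s) * h (s : AddCircle T)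
      map_add' := fun f g => by
        have hf := continuous_comp_coe f
        have hg := continuous_comp_coe g
        rw [← mul_add, ← intervalIntegral.integral_add]
        · simp [mul_add]
        · exact Continuous.intervalIntegrable (by fun_prop) _ _
        · exact Continuous.intervalIntegrable (by fun_prop) _ _
      map_smul' := fun c f => by
        simp only [ContinuousMap.smul_apply, smul_eq_mul, RingHom.id_apply, mul_left_comm _ c]
        rw [intervalIntegral.integral_const_mul, mul_left_comm] }
    (‖(expWeight T lam)⁻¹‖ * (Real.exp (‖lam‖ * T) * T)) fun h => by
      have := norm_integral_exp_mul_le (T := T) lam (h := fun s : ℝ => h (s : AddCircle T))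
        (t := T) ⟨hT.out.le, le_rfl⟩ (fun s => h.norm_coe_le_norm _)
      simp only [LinearMap.coe_mk, AddHom.coe_mk, norm_mul]
      calc _ ≤ ‖(expWeight T lam)⁻¹‖ * (Real.exp (‖lam‖ * T) * ‖h‖ * T) := by gcongr
        _ = _ := by ring

theorem periodicConst_apply (lam : ℂ) (h : C(AddCircle T, ℂ)) : periodicConst T lam h =
    (expWeight T lam)⁻¹ * ∫ s in (0 : ℝ)..T, exp (-lam * s) * h (s : AddCircle T) := rfl

/-- The solution of `q' = λ q + h - g`, `q(0) = 0`, where `g = periodicConst T λ h`. -/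
def periodicSolFun (T : ℝ) [hT : Fact (0 < T)] (lam : ℂ) (h : C(AddCircle T, ℂ)) (t : ℝ) : ℂ :=
  exp (lam * t) * ∫ s in (0 : ℝ)..t, exp (-lam * s) * (h (s : AddCircle T) - periodicConst T lam h)

theorem hasDerivAt_ofReal_exp_mul (lam : ℂ) (t : ℝ) :
    HasDerivAt (fun s : ℝ => exp (lam * s)) (lam * exp (lam * t)) t := by
  have := ((hasDerivAt_id (t : ℂ)).const_mul lam).cexp.comp_ofReal
  simpa [mul_comm] using this

theorem hasDerivAt_periodicSolFun (lam : ℂ) (h : C(AddCircle T, ℂ)) (t : ℝ) :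
    HasDerivAt (periodicSolFun T lam h)
      (lam * periodicSolFun T lam h t + h (t : AddCircle T) - periodicConst T lam h) t := by
  have hc := continuous_exp_mul_sub lam h (periodicConst T lam h)
  have h1 := intervalIntegral.integral_hasDerivAt_right (hc.intervalIntegrable 0 t)
    hc.aestronglyMeasurable.stronglyMeasurableAtFilter hc.continuousAt
  have h2 := (hasDerivAt_ofReal_exp_mul lam t).mul h1
  refine h2.congr_deriv ?_
  have h3 : exp (lam * t) * exp (-lam * t) = 1 := by rw [← Complex.exp_add]; simp
  rw [periodicSolFun]
  linear_combination (h (t : AddCircle T) - periodicConst T lam h) * h3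

/-- The constant is chosen so that the integral over [0, T] vanishes. What remains of the integral
up to t + T is a shifted copy carrying exp(-λT), which the prefactor exp(λT) cancels. -/
theorem periodicSolFun_periodic {lam : ℂ} (hlam : expWeight T lam ≠ 0) (h : C(AddCircle T, ℂ)) :
    Function.Periodic (periodicSolFun T lam h) T := fun t => by
  have hc := continuous_exp_mul_sub lam h (periodicConst T lam h)
  have h0 : ∫ s in (0 : ℝ)..T,
      exp (-lam * s) * (h (s : AddCircle T) - periodicConst T lam h) = 0 := by
    rw [integral_exp_mul_sub_const, periodicConst_apply]
    field_simp
    ring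
  have h1 : ∫ s in T..t + T, exp (-lam * s) * (h (s : AddCircle T) - periodicConst T lam h) =
      exp (-lam * T) *
        ∫ s in (0 : ℝ)..t, exp (-lam * s) * (h (s : AddCircle T) - periodicConst T lam h) := by
    rw [← intervalIntegral.integral_const_mul]
    have := intervalIntegral.integral_comp_add_right (a := 0) (b := t)
      (fun s : ℝ => exp (-lam * s) * (h (s : AddCircle T) - periodicConst T lam h)) T
    rw [zero_add] at this
    rw [← this]
    refine intervalIntegral.integral_congr fun s _ => ?_
    simp only [AddCircle.coe_add_period, ofReal_add, mul_add, Complex.exp_add]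
    ring
  rw [periodicSolFun, ← intervalIntegral.integral_add_adjacent_intervals
    (hc.intervalIntegrable 0 T) (hc.intervalIntegrable T (t + T)), h0, h1, zero_add, ofReal_add,
    mul_add, Complex.exp_add, periodicSolFun]
  have h3 : exp (lam * T) * exp (-lam * T) = 1 := by rw [← Complex.exp_add]; simp
  linear_combination (exp (lam * t) *
    ∫ s in (0 : ℝ)..t, exp (-lam * s) * (h (s : AddCircle T) - periodicConst T lam h)) * h3

theorem continuous_periodicSolFun (lam : ℂ) (h : C(AddCircle T, ℂ)) :
    Continuous (periodicSolFun T lam h) :=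
  continuous_iff_continuousAt.mpr fun t => (hasDerivAt_periodicSolFun lam h t).continuousAt

/-- The bounded operator `h ↦ q` where `q` is the `T`-periodic solution of `q' = λ q + h - g`,
`q(0) = 0`, for the only possible constant `g`. -/
def periodicSol (T : ℝ) [hT : Fact (0 < T)] (lam : ℂ) (hlam : expWeight T lam ≠ 0) :
    C(AddCircle T, ℂ) →L[ℂ] C(AddCircle T, ℂ) :=
  LinearMap.mkContinuous
    { toFun := fun h =>
        circleLift _ (continuous_periodicSolFun lam h) (periodicSolFun_periodic hlam h)
      map_add' := fun f g => by
        ext x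
        induction x using QuotientAddGroup.induction_on with | H t => ?_
        have hf := continuous_exp_mul_sub lam f (periodicConst T lam f)
        have hg := continuous_exp_mul_sub lam g (periodicConst T lam g)
        change periodicSolFun T lam (f + g) t = periodicSolFun T lam f t + periodicSolFun T lam g t
        simp only [periodicSolFun]
        rw [← mul_add, ← intervalIntegral.integral_add (hf.intervalIntegrable _ _)
          (hg.intervalIntegrable _ _), map_add]
        congr 1
        refine intervalIntegral.integral_congr fun s _ => ?_
        simp only [ContinuousMap.add_apply]
        ring
      map_smul' := fun c f => by
        ext x
        induction x using QuotientAddGroup.induction_on with | H t => ?_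
        change periodicSolFun T lam (c • f) t = c * periodicSolFun T lam f t
        simp only [periodicSolFun]
        rw [mul_left_comm, ← intervalIntegral.integral_const_mul (𝕜 := ℂ) c, map_smul]
        congr 1
        refine intervalIntegral.integral_congr fun s _ => ?_
        simp only [ContinuousMap.smul_apply, smul_eq_mul]
        ring }
    (Real.exp (‖lam‖ * T) * (Real.exp (‖lam‖ * T) * (1 + ‖periodicConst T lam‖) * T)) fun h => by
      have hT0 := hT.out.le
      refine (ContinuousMap.norm_le _ (by positivity)).mpr fun x => ?_
      -- By periodicity one period suffices, and there the exponentials are bounded.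
      obtain ⟨t, ht, rfl⟩ : x ∈ ((↑) : ℝ → AddCircle T) '' Set.Icc 0 (0 + T) := by
        rw [AddCircle.coe_image_Icc_eq]; trivial
      rw [zero_add] at ht
      change ‖periodicSolFun T lam h t‖ ≤ _
      have h1 := norm_integral_exp_mul_le (T := T) lam
        (h := fun s : ℝ => h (s : AddCircle T) - periodicConst T lam h)
        (C := (1 + ‖periodicConst T lam‖) * ‖h‖) ht (fun s => by
          have a1 := norm_sub_le (h (s : AddCircle T)) (periodicConst T lam h)
          have a2 := h.norm_coe_le_norm (s : AddCircle T)
          have a3 := (periodicConst T lam).le_opNorm h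
          linarith)
      rw [periodicSolFun, norm_mul]
      calc _ ≤ Real.exp (‖lam‖ * T) *
            (Real.exp (‖lam‖ * T) * ((1 + ‖periodicConst T lam‖) * ‖h‖) * T) := by
            gcongr
            exact norm_exp_mul_ofReal_le lam ht
        _ = _ := by ring

theorem periodicSol_coe {lam : ℂ} (hlam : expWeight T lam ≠ 0) (h : C(AddCircle T, ℂ)) (t : ℝ) :
    periodicSol T lam hlam h (t : AddCircle T) = periodicSolFun T lam h t := rfl

theorem periodicSol_zero {lam : ℂ} (hlam : expWeight T lam ≠ 0) (h : C(AddCircle T, ℂ)) :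
    periodicSol T lam hlam h ((0 : ℝ) : AddCircle T) = 0 := by
  rw [periodicSol_coe]
  simp [periodicSolFun]

theorem hasDerivAt_periodicSol {lam : ℂ} (hlam : expWeight T lam ≠ 0) (h : C(AddCircle T, ℂ))
    (t : ℝ) : HasDerivAt (fun s : ℝ => periodicSol T lam hlam h (s : AddCircle T))
      (lam * periodicSol T lam hlam h (t : AddCircle T) + h (t : AddCircle T) -
        periodicConst T lam h) t :=
  hasDerivAt_periodicSolFun lam h t

/-- The integrating factor exp(-λt) expresses q as an integral; q(T) = q(0) = 0 then determines g
because the weight is nonzero. Besides uniqueness, this lets the operators be computed by exhibiting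
a solution. -/
theorem eq_periodicSol {lam : ℂ} (hlam : expWeight T lam ≠ 0) {q h : C(AddCircle T, ℂ)} {g : ℂ}
    (hq0 : q ((0 : ℝ) : AddCircle T) = 0)
    (hq : ∀ t : ℝ, HasDerivAt (fun s : ℝ => q (s : AddCircle T))
      (lam * q (t : AddCircle T) + h (t : AddCircle T) - g) t) :
    g = periodicConst T lam h ∧ q = periodicSol T lam hlam h := by
  have hc := continuous_exp_mul_sub lam h g
  have h1 : ∀ t : ℝ, exp (-lam * t) * q (t : AddCircle T) =
      ∫ s in (0 : ℝ)..t, exp (-lam * s) * (h (s : AddCircle T) - g) := fun t => by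
    have hd : ∀ s : ℝ, HasDerivAt (fun s : ℝ => exp (-lam * s) * q (s : AddCircle T))
        (exp (-lam * s) * (h (s : AddCircle T) - g)) s := fun s =>
      ((hasDerivAt_ofReal_exp_mul (-lam) s).mul (hq s)).congr_deriv (by ring)
    rw [intervalIntegral.integral_eq_sub_of_hasDerivAt (fun s _ => hd s)
      (hc.intervalIntegrable _ _), hq0]
    ring
  have hg : g = periodicConst T lam h := by
    have hqT : q ((T : ℝ) : AddCircle T) = 0 := by
      rw [AddCircle.coe_period, ← hq0]; simp
    have h2 := h1 T
    rw [integral_exp_mul_sub_const, hqT, mul_zero, eq_comm, sub_eq_zero] at h2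
    rw [periodicConst_apply, h2]
    field_simp
  refine ⟨hg, ?_⟩
  ext x
  induction x using QuotientAddGroup.induction_on with | H t => ?_
  change q (t : AddCircle T) = periodicSolFun T lam h t
  rw [periodicSolFun, ← hg, ← h1, ← mul_assoc, ← Complex.exp_add]
  simp

/-- The function `t ↦ exp(2πi m t / T)` on the circle. -/
def circleExp (T : ℝ) [hT : Fact (0 < T)] (m : ℤ) : C(AddCircle T, ℂ) :=
  circleLift (fun t : ℝ => exp (2 * Real.pi * I / T * m * t)) (by fun_prop) fun t => by
    have hTc : (T : ℂ) ≠ 0 := by exact_mod_cast hT.out.ne'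
    simp only [ofReal_add, mul_add, Complex.exp_add]
    have : exp (2 * Real.pi * I / T * m * T) = 1 :=
      Complex.exp_eq_one_iff.mpr ⟨m, by field_simp⟩
    rw [this, mul_one]

theorem circleExp_coe (m : ℤ) (t : ℝ) :
    circleExp T m (t : AddCircle T) = exp (2 * Real.pi * I / T * m * t) := rfl

/-- Explicit solutions are guessed and identified by uniqueness: q = 0, g = 1 for the constant mode,
and a multiple of exp(μt) - 1 for the others, the -1 enforcing q(0) = 0. -/
theorem periodic_circleExp {lam : ℂ} (hlam : expWeight T lam ≠ 0)
    (hl : ∀ m : ℤ, lam = 2 * Real.pi * I / T * m → m = 0) (m : ℤ) :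
    (periodicConst T lam (circleExp T m) =
      if m = 0 then 1 else -lam / (2 * Real.pi * I / T * m - lam)) ∧
    ∀ t : ℝ, periodicSol T lam hlam (circleExp T m) (t : AddCircle T) =
      if m = 0 then 0 else
        (exp (2 * Real.pi * I / T * m * t) - 1) / (2 * Real.pi * I / T * m - lam) := by
  set μ : ℂ := 2 * Real.pi * I / T * m with hμ
  by_cases hm : m = 0
  · have := eq_periodicSol hlam (q := 0) (h := circleExp T m) (g := 1) rfl fun t => by
      simpa [circleExp_coe, hm] using hasDerivAt_const t (0 : ℂ)
    rw [← this.1, ← this.2]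
    simp [hm]
  · have hd : μ - lam ≠ 0 := fun h => hm (hl m (by rw [← hμ]; linear_combination -h))
    have := eq_periodicSol hlam (q := (μ - lam)⁻¹ • (circleExp T m - 1)) (h := circleExp T m)
      (g := -lam / (μ - lam)) (by
        rw [ContinuousMap.smul_apply, ContinuousMap.sub_apply, circleExp_coe]; simp) fun t => by
        have h1 := ((hasDerivAt_ofReal_exp_mul μ t).sub_const 1).const_mul (μ - lam)⁻¹
        simp only [ContinuousMap.smul_apply, ContinuousMap.sub_apply, ContinuousMap.one_apply,
          circleExp_coe, smul_eq_mul, ← hμ]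
        refine h1.congr_deriv ?_
        field_simp
        ring
    rw [← this.1, ← this.2]
    simp only [hm, if_false, true_and]
    intro t
    rw [ContinuousMap.smul_apply, ContinuousMap.sub_apply, circleExp_coe, ← hμ,
      ContinuousMap.one_apply, smul_eq_mul, div_eq_inv_mul]

end Periodic

end

/-! ### From Floquet decompositions to the reduced system. -/

noncomputable section
open Filter Topology MeasureTheory intervalIntegral Complex
section Bridge
attribute [local instance] Matrix.linftyOpNormedRing Matrix.linftyOpNormedAlgebra

variable {N : ℕ}

theorem hasDerivAt_matrix {X : ℝ → Matrix (Fin N) (Fin N) ℂ} {X' : Matrix (Fin N) (Fin N) ℂ}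
    {t : ℝ} : HasDerivAt X X' t ↔ ∀ k l, HasDerivAt (fun s => X s k l) (X' k l) t := by
  refine (hasDerivAt_pi (φ := X) (φ' := X')).trans (forall_congr' fun k => ?_)
  exact hasDerivAt_pi

theorem hasDerivAt_exp_ofReal_smul (F : Matrix (Fin N) (Fin N) ℂ) (t : ℝ) :
    HasDerivAt (fun s : ℝ => NormedSpace.exp ((s : ℂ) • F))
      (F * NormedSpace.exp ((t : ℂ) • F)) t := by
  refine ((hasDerivAt_exp_smul_const' F (t : ℂ)).scomp t Complex.ofRealCLM.hasDerivAt).congr_deriv ?_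
  rw [Complex.ofRealCLM_apply, Complex.ofReal_one, one_smul]
  rfl

/-- `P(t) exp(F t)` is the fundamental solution iff `P(0) = 1` and `P' = A P - P F`. -/
theorem isFundamentalSolution_mul_exp_iff {A P : ℝ → Matrix (Fin N) (Fin N) ℂ}
    {F : Matrix (Fin N) (Fin N) ℂ} :
    IsFundamentalSolution A (fun t => P t * NormedSpace.exp ((t : ℂ) • F)) ↔
      P 0 = 1 ∧ ∀ t k l, HasDerivAt (fun s => P s k l) ((A t * P t - P t * F) k l) t := by
  have hexp : ∀ t : ℝ, NormedSpace.exp ((t : ℂ) • F) * NormedSpace.exp ((t : ℂ) • -F) = 1 :=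
    fun t => by
      rw [smul_neg, ← Matrix.exp_add_of_commute _ _ (Commute.refl ((t : ℂ) • F)).neg_right,
        add_neg_cancel, NormedSpace.exp_zero]
  have hcommn : ∀ t : ℝ,
      F * NormedSpace.exp ((t : ℂ) • -F) = NormedSpace.exp ((t : ℂ) • -F) * F :=
    fun t => ((((Commute.refl F).neg_right).smul_right (t : ℂ)).exp_right).eq
  simp only [IsFundamentalSolution, ← hasDerivAt_matrix]
  refine and_congr (by simp) (forall_congr' fun t => ⟨fun h => ?_, fun h => ?_⟩)
  -- Recover P from the fundamental solution by multiplying with exp(-tF) on the right.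
  · have h1 := h.mul (hasDerivAt_exp_ofReal_smul (-F) t)
    have e : (fun t : ℝ => P t * NormedSpace.exp ((t : ℂ) • F)) *
        (fun s : ℝ => NormedSpace.exp ((s : ℂ) • -F)) = P := by
      funext s
      simp only [Pi.mul_apply]
      rw [mul_assoc, hexp, mul_one]
    rw [e] at h1
    refine h1.congr_deriv ?_
    rw [neg_mul, hcommn, mul_neg, ← mul_assoc (A t), mul_assoc _ (NormedSpace.exp _), hexp, mul_one,
      ← mul_assoc (P t * _), mul_assoc (P t), hexp, mul_one, sub_eq_add_neg]
  · refine (h.mul (hasDerivAt_exp_ofReal_smul F t)).congr_deriv ?_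
    rw [sub_mul, mul_assoc (P t), sub_add_cancel, mul_assoc]

/-- The continuous linear map acting on matrices entry by entry. -/
def entrywiseCLM {α β : Type*} [NormedRing α] [NormedAlgebra ℂ α] [NormedRing β] [NormedAlgebra ℂ β]
    (L : Fin N → Fin N → α →L[ℂ] β) : Matrix (Fin N) (Fin N) α →L[ℂ] Matrix (Fin N) (Fin N) β where
  toFun M := Matrix.of fun k l => L k l (M k l)
  map_add' M M' := by ext; simp
  map_smul' c M := by ext; simp
  cont := by
    refine continuous_pi fun k => continuous_pi fun l => ?_
    exact (L k l).continuous.comp ((continuous_apply l).comp (continuous_apply k))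

theorem entrywiseCLM_apply {α β : Type*} [NormedRing α] [NormedAlgebra ℂ α] [NormedRing β]
    [NormedAlgebra ℂ β] (L : Fin N → Fin N → α →L[ℂ] β) (M : Matrix (Fin N) (Fin N) α)
    (k l : Fin N) : entrywiseCLM L M k l = L k l (M k l) := rfl

/-- The diagonal matrix with entries `exp(2πi n_k t / T)`. -/
def foldingMatrix (T : ℝ) (n : Fin N → ℤ) (t : ℝ) : Matrix (Fin N) (Fin N) ℂ :=
  Matrix.diagonal fun k => exp (2 * Real.pi * I / T * n k * t)

theorem foldingMatrix_mul_apply {T : ℝ} (n : Fin N → ℤ) (t : ℝ) (M : Matrix (Fin N) (Fin N) ℂ)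
    (k l : Fin N) :
    (foldingMatrix T n t * M) k l = exp (2 * Real.pi * I / T * n k * t) * M k l :=
  Matrix.diagonal_mul _ _ _ _

theorem foldingMatrix_zero {T : ℝ} (n : Fin N → ℤ) : foldingMatrix T n 0 = 1 := by
  simp [foldingMatrix]

variable {T : ℝ} [hT : Fact (0 < T)]

/-- Evaluation at `t` of a matrix of functions on the circle. -/
def evalMatrix (T : ℝ) [hT : Fact (0 < T)] (t : ℝ) :
    Matrix (Fin N) (Fin N) C(AddCircle T, ℂ) →L[ℂ] Matrix (Fin N) (Fin N) ℂ :=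
  entrywiseCLM fun _ _ => ContinuousMap.evalCLM ℂ (t : AddCircle T)

theorem evalMatrix_apply (t : ℝ) (M : Matrix (Fin N) (Fin N) C(AddCircle T, ℂ)) (k l : Fin N) :
    evalMatrix T t M k l = M k l (t : AddCircle T) := rfl

theorem evalMatrix_mul (t : ℝ) (M M' : Matrix (Fin N) (Fin N) C(AddCircle T, ℂ)) :
    evalMatrix T t (M * M') = evalMatrix T t M * evalMatrix T t M' := by
  ext k l
  simp [evalMatrix_apply, Matrix.mul_apply]

theorem evalMatrix_one (t : ℝ) :
    evalMatrix T t (1 : Matrix (Fin N) (Fin N) C(AddCircle T, ℂ)) = 1 := by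
  ext k l
  by_cases h : k = l <;> simp [evalMatrix_apply, Matrix.one_apply, h]

/-- A constant matrix as a matrix of functions on the circle. -/
def constMatrix (T : ℝ) [hT : Fact (0 < T)] :
    Matrix (Fin N) (Fin N) ℂ →L[ℂ] Matrix (Fin N) (Fin N) C(AddCircle T, ℂ) :=
  entrywiseCLM fun _ _ => ContinuousLinearMap.toSpanSingleton ℂ (1 : C(AddCircle T, ℂ))

theorem evalMatrix_constMatrix (t : ℝ) (G : Matrix (Fin N) (Fin N) ℂ) :
    evalMatrix T t (constMatrix T G) = G := by
  ext k l
  simp [evalMatrix_apply, constMatrix, entrywiseCLM_apply]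

theorem foldingMatrix_periodic (n : Fin N → ℤ) : Function.Periodic (foldingMatrix T n) T :=
  fun t => by
    have h := fun k => congrArg (circleExp T (n k)) (AddCircle.coe_add_period T t)
    simp only [circleExp_coe] at h
    simp only [foldingMatrix, h]

/-- The system satisfied by `Q` when `P = D Q` with `D` the folding matrix, `F = diag(f) + G`. -/
def IsReducedSolution (f : Fin N → ℂ) (B Q : Matrix (Fin N) (Fin N) C(AddCircle T, ℂ))
    (G : Matrix (Fin N) (Fin N) ℂ) : Prop :=
  evalMatrix T 0 Q = 1 ∧ ∀ (t : ℝ) (k l : Fin N),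
    HasDerivAt (fun s : ℝ => Q k l (s : AddCircle T))
      ((f k - f l) * (Q - 1) k l (t : AddCircle T) +
        (B * Q - (Q - 1) * constMatrix T G) k l (t : AddCircle T) - G k l) t

/-- Differentiating D contributes (2πi/T) n_k in row k, exactly the gap between a_k and f_k, so the
unfolded exponents are replaced by the folded ones. -/
theorem isFloquetDecomposition_iff_isReducedSolution {f a : Fin N → ℂ} {n : Fin N → ℤ}
    (ha : ∀ k, a k = f k + 2 * Real.pi * I / T * n k)
    {A : ℝ → Matrix (Fin N) (Fin N) ℂ} {B Q : Matrix (Fin N) (Fin N) C(AddCircle T, ℂ)}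
    (hB : ∀ t, A t * foldingMatrix T n t =
      foldingMatrix T n t * (Matrix.diagonal a + evalMatrix T t B))
    {G : Matrix (Fin N) (Fin N) ℂ} :
    IsFloquetDecomposition T A (Matrix.diagonal f + G)
      (fun t => foldingMatrix T n t * evalMatrix T t Q) ↔ IsReducedSolution f B Q G := by
  have hper : Function.Periodic (fun t => foldingMatrix T n t * evalMatrix T t Q) T := fun t => by
    have : evalMatrix T (t + T) Q = evalMatrix T t Q := by
      ext k l
      rw [evalMatrix_apply, evalMatrix_apply, AddCircle.coe_add_period]
    simp only [foldingMatrix_periodic n t, this]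
  have hiff : IsFloquetDecomposition T A (Matrix.diagonal f + G)
      (fun t => foldingMatrix T n t * evalMatrix T t Q) ↔
      IsFundamentalSolution A (fun t => (foldingMatrix T n t * evalMatrix T t Q) *
        NormedSpace.exp ((t : ℂ) • (Matrix.diagonal f + G))) := ⟨fun h => h.2, fun h => ⟨hper, h⟩⟩
  rw [hiff, isFundamentalSolution_mul_exp_iff, IsReducedSolution]
  refine and_congr (by rw [foldingMatrix_zero, one_mul]) ?_
  refine forall_congr' fun t => forall_congr' fun k => forall_congr' fun l => ?_
  set e : ℂ := 2 * Real.pi * I / T * n k with he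
  have hP : (fun s : ℝ => (foldingMatrix T n s * evalMatrix T s Q) k l) =
      fun s : ℝ => exp (e * s) * Q k l (s : AddCircle T) := by
    funext s; rw [foldingMatrix_mul_apply, evalMatrix_apply]
  have hmat : A t * (foldingMatrix T n t * evalMatrix T t Q) -
      foldingMatrix T n t * evalMatrix T t Q * (Matrix.diagonal f + G) =
      foldingMatrix T n t * (Matrix.diagonal a * evalMatrix T t Q -
        evalMatrix T t Q * Matrix.diagonal f + evalMatrix T t (B * Q - Q * constMatrix T G)) := by
    rw [← mul_assoc, hB, map_sub, evalMatrix_mul, evalMatrix_mul, evalMatrix_constMatrix]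
    noncomm_ring
  have hentry : (A t * (foldingMatrix T n t * evalMatrix T t Q) -
      foldingMatrix T n t * evalMatrix T t Q * (Matrix.diagonal f + G)) k l =
      exp (e * t) * ((a k - f l) * Q k l (t : AddCircle T) +
        (B * Q - Q * constMatrix T G) k l (t : AddCircle T)) := by
    rw [hmat, foldingMatrix_mul_apply, Matrix.add_apply, Matrix.sub_apply, Matrix.diagonal_mul,
      Matrix.mul_diagonal, evalMatrix_apply, evalMatrix_apply]
    ring
  -- Replacing Q by Q - 1 costs nothing in the first term, as (f_k - f_l) δ_kl = 0, and splits Q G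
  -- into (Q - 1) G + G. This isolates the constant `G k l` in a problem with zero initial value.
  have hred : (f k - f l) * (Q - 1) k l (t : AddCircle T) +
      (B * Q - (Q - 1) * constMatrix T G) k l (t : AddCircle T) - G k l =
      (f k - f l) * Q k l (t : AddCircle T) +
        (B * Q - Q * constMatrix T G) k l (t : AddCircle T) := by
    have h1 : constMatrix T G k l (t : AddCircle T) = G k l := by
      rw [← evalMatrix_apply, evalMatrix_constMatrix]
    have h2 : (f k - f l) * (1 : Matrix (Fin N) (Fin N) C(AddCircle T, ℂ)) k l (t : AddCircle T)
        = 0 := by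
      by_cases h : k = l <;> simp [h]
    have h3 : B * Q - (Q - 1) * constMatrix T G = B * Q - Q * constMatrix T G + constMatrix T G := by
      noncomm_ring
    rw [h3, Matrix.add_apply, Matrix.sub_apply Q, ContinuousMap.add_apply, ContinuousMap.sub_apply,
      h1]
    linear_combination -h2
  rw [hP, hentry, hred]
  constructor
  · intro h
    have h1 := (hasDerivAt_ofReal_exp_mul (-e) t).mul h
    have hee : ∀ s : ℝ, exp (-e * s) * exp (e * s) = 1 := fun s => by
      rw [← Complex.exp_add]; simp
    have e1 : ((fun s : ℝ => exp (-e * s)) * fun s : ℝ => exp (e * s) * Q k l (s : AddCircle T)) =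
        fun s : ℝ => Q k l (s : AddCircle T) := by
      funext s
      simp only [Pi.mul_apply]
      rw [← mul_assoc, hee, one_mul]
    rw [e1] at h1
    refine h1.congr_deriv ?_
    rw [ha]
    linear_combination (-e * Q k l (t : AddCircle T) + (f k + e - f l) * Q k l (t : AddCircle T) +
        (B * Q - Q * constMatrix T G) k l (t : AddCircle T)) * hee t
  · intro h
    refine ((hasDerivAt_ofReal_exp_mul e t).mul h).congr_deriv ?_
    rw [ha]
    ring

/-- The solution operator of the linearised reduced system. -/
def reducedSol (f : Fin N → ℂ) (hf : ∀ k l, expWeight T (f k - f l) ≠ 0) :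
    Matrix (Fin N) (Fin N) C(AddCircle T, ℂ) →L[ℂ] Matrix (Fin N) (Fin N) C(AddCircle T, ℂ) :=
  entrywiseCLM fun k l => periodicSol T (f k - f l) (hf k l)

/-- The exponent correction of the linearised reduced system. -/
def reducedConst (T : ℝ) [hT : Fact (0 < T)] (f : Fin N → ℂ) :
    Matrix (Fin N) (Fin N) C(AddCircle T, ℂ) →L[ℂ] Matrix (Fin N) (Fin N) ℂ :=
  entrywiseCLM fun k l => periodicConst T (f k - f l)

/-- Once the source B Q - (Q - 1) G is treated as given, the entries decouple into scalar problems
with λ = f_k - f_l, each having exactly one solution pair. -/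
theorem isReducedSolution_iff {f : Fin N → ℂ} (hf : ∀ k l, expWeight T (f k - f l) ≠ 0)
    {B Q : Matrix (Fin N) (Fin N) C(AddCircle T, ℂ)} {G : Matrix (Fin N) (Fin N) ℂ} :
    IsReducedSolution f B Q G ↔
      G = reducedConst T f (B * Q - (Q - 1) * constMatrix T G) ∧
      Q - 1 = reducedSol f hf (B * Q - (Q - 1) * constMatrix T G) := by
  set h := B * Q - (Q - 1) * constMatrix T G with hh
  have hder : ∀ (t : ℝ) (k l : Fin N) (d : ℂ),
      HasDerivAt (fun s : ℝ => (Q - 1) k l (s : AddCircle T)) d t ↔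
      HasDerivAt (fun s : ℝ => Q k l (s : AddCircle T)) d t := fun t k l d => by
    have : (fun s : ℝ => (Q - 1) k l (s : AddCircle T)) = fun s : ℝ => Q k l (s : AddCircle T) -
        (1 : Matrix (Fin N) (Fin N) ℂ) k l := by
      funext s
      rw [← evalMatrix_apply, map_sub, evalMatrix_one, Matrix.sub_apply, evalMatrix_apply]
    rw [this, hasDerivAt_sub_const_iff]
  constructor
  · rintro ⟨h0, h1⟩
    have key : ∀ k l, G k l = periodicConst T (f k - f l) (h k l) ∧
        (Q - 1) k l = periodicSol T (f k - f l) (hf k l) (h k l) := fun k l => by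
      refine eq_periodicSol (hf k l) ?_ fun t => (hder t k l _).mpr (h1 t k l)
      rw [← evalMatrix_apply, map_sub, evalMatrix_one, h0, sub_self, Matrix.zero_apply]
    exact ⟨Matrix.ext fun k l => (key k l).1, Matrix.ext fun k l => (key k l).2⟩
  · rintro ⟨hG, hQ⟩
    refine ⟨?_, fun t k l => ?_⟩
    · rw [← sub_eq_zero, ← evalMatrix_one (T := T) 0, ← map_sub, hQ]
      ext k l
      exact periodicSol_zero (hf k l) (h k l)
    · rw [← hder]
      have hG' : G k l = periodicConst T (f k - f l) (h k l) := by
        nth_rewrite 1 [hG]; rfl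
      have hQ' : (Q - 1) k l = periodicSol T (f k - f l) (hf k l) (h k l) := by
        rw [hQ]; rfl
      rw [hG', hQ', ← hh]
      exact hasDerivAt_periodicSol (hf k l) (h k l) t

end Bridge

end

/-! ### The analytic family: existence and first order coefficients. -/

noncomputable section
open Filter Topology MeasureTheory intervalIntegral Complex
section Family
attribute [local instance] Matrix.linftyOpNormedRing Matrix.linftyOpNormedAlgebra

variable {N : ℕ}

theorem IsLeadingExponent.eq_add {T : ℝ} (hT : 0 < T) {A₀ F₀ : Matrix (Fin N) (Fin N) ℂ}
    {n : Fin N → ℤ} (h : IsLeadingExponent T A₀ F₀ n) (k : Fin N) :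
    A₀ k k = F₀ k k + 2 * Real.pi * I / T * n k := by
  have hTc : (T : ℂ) ≠ 0 := by exact_mod_cast hT.ne'
  have hpi : (Real.pi : ℂ) ≠ 0 := by exact_mod_cast Real.pi_ne_zero
  have hI := I_ne_zero
  rw [h.folding k, Matrix.sub_apply]
  field_simp
  ring

/-- Two points of a half-open interval of length 2π/T differ by less than 2π/T, so |m| < 1. -/
theorem IsLeadingExponent.nonresonant {T : ℝ} (hT : 0 < T) {A₀ F₀ : Matrix (Fin N) (Fin N) ℂ}
    {n : Fin N → ℤ} (h : IsLeadingExponent T A₀ F₀ n) (k l : Fin N) (m : ℤ)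
    (hm : F₀ k k - F₀ l l = 2 * Real.pi * I / T * m) : m = 0 := by
  have him := congrArg Complex.im hm
  have e : (2 * Real.pi * I / T * m : ℂ) = ((2 * (Real.pi / T) * m : ℝ) : ℂ) * I := by
    push_cast; ring
  rw [e, Complex.sub_im, Complex.im_ofReal_mul, Complex.I_im, mul_one] at him
  have h1 := h.im_mem k
  have h2 := h.im_mem l
  have hp : 0 < Real.pi / T := div_pos Real.pi_pos hT
  have h3 : (m : ℝ) < 1 := by
    by_contra hc
    nlinarith [h1.1, h1.2, h2.1, h2.2, not_lt.mp hc]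
  have h4 : (-1 : ℝ) < m := by
    by_contra hc
    nlinarith [h1.1, h1.2, h2.1, h2.2, not_lt.mp hc]
  have h5 : m < 1 := by exact_mod_cast h3
  have h6 : -1 < m := by exact_mod_cast h4
  omega

variable {T : ℝ} [hT : Fact (0 < T)]

theorem norm_circleExp_coe (m : ℤ) (t : ℝ) : ‖circleExp T m (t : AddCircle T)‖ = 1 := by
  have e : (2 * Real.pi * I / T * m * t : ℂ) = ((2 * Real.pi / T * m * t : ℝ) : ℂ) * I := by
    push_cast; ring
  rw [circleExp_coe, e, Complex.norm_exp_ofReal_mul_I]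

/-- The Taylor coefficients in `ε` of the perturbation `D(t)⁻¹ (A_ε(t) - A_0) D(t)`. -/
def reducedCoeff (T : ℝ) [hT : Fact (0 < T)] (n : Fin N → ℤ)
    (c : ℕ → ℤ →₀ Matrix (Fin N) (Fin N) ℂ) (j : ℕ) : Matrix (Fin N) (Fin N) C(AddCircle T, ℂ) :=
  -- A₀ has been subtracted, and `c 0` is unconstrained, so it must not enter.
  if j = 0 then 0 else
    Matrix.of fun k l => (c j).sum fun m M => M k l • circleExp T (m + n l - n k)

theorem reducedCoeff_coe {n : Fin N → ℤ} {c : ℕ → ℤ →₀ Matrix (Fin N) (Fin N) ℂ} {j : ℕ}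
    (hj : j ≠ 0) (k l : Fin N) (t : ℝ) : reducedCoeff T n c j k l (t : AddCircle T) =
      circleExp T (n l - n k) (t : AddCircle T) * finiteFourierSeries T (c j) t k l := by
  simp only [reducedCoeff, hj, if_false, Matrix.of_apply, finiteFourierSeries, Finsupp.sum]
  rw [ContinuousMap.sum_apply, Matrix.sum_apply, Finset.mul_sum]
  refine Finset.sum_congr rfl fun m _ => ?_
  simp only [ContinuousMap.smul_apply, circleExp_coe, Matrix.smul_apply, smul_eq_mul]
  have : exp (2 * Real.pi * I / T * ((m + n l - n k : ℤ) : ℂ) * t) =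
      exp (2 * Real.pi * I / T * ((n l - n k : ℤ) : ℂ) * t) * exp (2 * Real.pi * I / T * m * t) := by
    rw [← Complex.exp_add]; push_cast; ring_nf
  rw [this]
  ring

variable {r₀ : ℝ} {A : ℂ → ℝ → Matrix (Fin N) (Fin N) ℂ} {A₀ : Matrix (Fin N) (Fin N) ℂ}
  {Ac : ℕ → ℝ → Matrix (Fin N) (Fin N) ℂ} {c : ℕ → ℤ →₀ Matrix (Fin N) (Fin N) ℂ}

open Classical in
/-- The perturbation `D(t)⁻¹ (A_ε(t) - A_0) D(t)`, where `D` is the folding matrix, for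
`‖ε‖ < r₀`. -/
def reducedFamily (hA : IsAnalyticPeriodicFamily T r₀ A A₀ Ac c) (n : Fin N → ℤ) (ε : ℂ) :
    Matrix (Fin N) (Fin N) C(AddCircle T, ℂ) :=
  if h : ‖ε‖ < r₀ then
    Matrix.of fun k l => circleExp T (n l - n k) *
      circleLift (fun t => A ε t k l - A₀ k l)
        (((continuous_apply l).comp ((continuous_apply k).comp (hA.continuous ε h))).sub
          continuous_const)
        (fun t => by simp only [hA.periodic ε h t])
  else 0

theorem reducedFamily_coe (hA : IsAnalyticPeriodicFamily T r₀ A A₀ Ac c) (n : Fin N → ℤ) {ε : ℂ}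
    (h : ‖ε‖ < r₀) (k l : Fin N) (t : ℝ) : reducedFamily hA n ε k l (t : AddCircle T) =
      circleExp T (n l - n k) (t : AddCircle T) * (A ε t k l - A₀ k l) := by
  rw [reducedFamily, dif_pos h]
  rfl

/-- Uniform convergence in t is convergence in the sup norm on the circle, and the conjugating
exponentials have modulus one. -/
theorem tendsto_reducedFamily (hA : IsAnalyticPeriodicFamily T r₀ A A₀ Ac c) (n : Fin N → ℤ) {ε : ℂ}
    (h : ‖ε‖ < r₀) :
    Tendsto (fun p => ∑ j ∈ Finset.range p, ε ^ j • reducedCoeff T n c j) atTop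
      (𝓝 (reducedFamily hA n ε)) := by
  refine tendsto_pi_nhds.mpr fun k => tendsto_pi_nhds.mpr fun l => ?_
  rw [ContinuousMap.tendsto_iff_tendstoUniformly, Metric.tendstoUniformly_iff]
  intro δ hδ
  filter_upwards [Metric.tendstoUniformly_iff.mp (hA.expansion ε h k l) δ hδ,
    eventually_ge_atTop 1] with m hm hm1 x
  induction x using QuotientAddGroup.induction_on with | H t => ?_
  have hsum : (∑ j ∈ Finset.range m, ε ^ j • reducedCoeff T n c j) k l (t : AddCircle T) =
      circleExp T (n l - n k) (t : AddCircle T) *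
        ((∑ j ∈ Finset.range m, ε ^ j • Ac j t) k l - A₀ k l) := by
    -- A nonempty partial sum is needed: its j = 0 term is what cancels A₀.
    obtain ⟨m, rfl⟩ : ∃ m', m = m' + 1 := ⟨m - 1, by omega⟩
    rw [Finset.sum_range_succ', Finset.sum_range_succ', Matrix.add_apply, Matrix.add_apply]
    have e0 : reducedCoeff T n c 0 = 0 := by simp [reducedCoeff]
    rw [e0, smul_zero, Matrix.zero_apply, add_zero, hA.coeff_zero, pow_zero, one_smul,
      add_sub_cancel_right, Matrix.sum_apply, Matrix.sum_apply, ContinuousMap.sum_apply,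
      Finset.mul_sum]
    refine Finset.sum_congr rfl fun j _ => ?_
    rw [Matrix.smul_apply, ContinuousMap.smul_apply, reducedCoeff_coe (Nat.succ_ne_zero j),
      hA.coeff_fourier (j + 1) (by omega), Matrix.smul_apply, smul_eq_mul, smul_eq_mul]
    ring
  have hdist := hm t
  change dist (reducedFamily hA n ε k l (t : AddCircle T))
    ((∑ j ∈ Finset.range m, ε ^ j • reducedCoeff T n c j) k l (t : AddCircle T)) < δ
  rw [reducedFamily_coe hA n h, hsum, dist_eq_norm, ← mul_sub, sub_sub_sub_cancel_right, norm_mul,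
    norm_circleExp_coe, one_mul, ← dist_eq_norm]
  exact hdist

theorem reducedFamily_conj (hA : IsAnalyticPeriodicFamily T r₀ A A₀ Ac c) (n : Fin N → ℤ) {ε : ℂ}
    (h : ‖ε‖ < r₀) (t : ℝ) : A ε t * foldingMatrix T n t =
      foldingMatrix T n t *
        (Matrix.diagonal (fun k => A₀ k k) + evalMatrix T t (reducedFamily hA n ε)) := by
  ext k l
  have h0 : Matrix.diagonal (fun k => A₀ k k) = A₀ := hA.diagonal.diagonal_diag
  have e1 : exp (2 * Real.pi * I / T * n k * t) *
      exp (2 * Real.pi * I / T * ((n l - n k : ℤ) : ℂ) * t) =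
      exp (2 * Real.pi * I / T * n l * t) := by
    rw [← Complex.exp_add]; push_cast; ring_nf
  have e2 : exp (2 * Real.pi * I / T * n k * t) * A₀ k l =
      exp (2 * Real.pi * I / T * n l * t) * A₀ k l := by
    by_cases hkl : k = l
    · rw [hkl]
    · rw [hA.diagonal hkl]; simp
  rw [foldingMatrix_mul_apply, Matrix.add_apply, evalMatrix_apply, reducedFamily_coe hA n h, h0,
    foldingMatrix, Matrix.mul_diagonal, circleExp_coe]
  linear_combination -e2 - (A ε t k l - A₀ k l) * e1

instance completeSpace_circleMatrix :
    @CompleteSpace (Matrix (Fin N) (Fin N) C(AddCircle T, ℂ)) PseudoMetricSpace.toUniformSpace :=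
  inferInstanceAs (CompleteSpace (Fin N → Fin N → C(AddCircle T, ℂ)))

theorem hasFPowerSeriesAt_reducedFamily (hr₀ : 0 < r₀)
    (hA : IsAnalyticPeriodicFamily T r₀ A A₀ Ac c) (n : Fin N → ℤ) :
    HasFPowerSeriesAt (reducedFamily hA n)
      (fun j => ContinuousMultilinearMap.mkPiRing ℂ (Fin j) (reducedCoeff T n c j)) 0 :=
  hasFPowerSeriesAt_of_tendsto_partialSum hr₀ fun _ hε => tendsto_reducedFamily hA n hε

theorem reducedFamily_zero (hr₀ : 0 < r₀)
    (hA : IsAnalyticPeriodicFamily T r₀ A A₀ Ac c) (n : Fin N → ℤ) :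
    reducedFamily hA n 0 = 0 := by
  rw [← (hasFPowerSeriesAt_reducedFamily hr₀ hA n).coeff_zero 0]
  simp [reducedCoeff]

variable {F₀ : Matrix (Fin N) (Fin N) ℂ} {n : Fin N → ℤ}

theorem IsLeadingExponent.expWeight_ne_zero (hF₀ : IsLeadingExponent T A₀ F₀ n) (k l : Fin N) :
    expWeight T (F₀ k k - F₀ l l) ≠ 0 :=
  _root_.expWeight_ne_zero hT.out (hF₀.nonresonant hT.out k l)

/-- This holds at each fixed ε in the disc, with no smallness beyond it. One direction serves
existence, the other the analysis of an arbitrary decomposition. -/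
theorem isFloquetDecomposition_iff_reduced (hA : IsAnalyticPeriodicFamily T r₀ A A₀ Ac c)
    (hF₀ : IsLeadingExponent T A₀ F₀ n) {ε : ℂ} (hε : ‖ε‖ < r₀)
    {Q : Matrix (Fin N) (Fin N) C(AddCircle T, ℂ)} {G : Matrix (Fin N) (Fin N) ℂ} :
    IsFloquetDecomposition T (A ε) (F₀ + G) (fun t => foldingMatrix T n t * evalMatrix T t Q) ↔
      G = reducedConst T (fun k => F₀ k k)
        (reducedFamily hA n ε * Q - (Q - 1) * constMatrix T G) ∧
      Q - 1 = reducedSol (fun k => F₀ k k) hF₀.expWeight_ne_zero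
        (reducedFamily hA n ε * Q - (Q - 1) * constMatrix T G) := by
  rw [← isReducedSolution_iff, ← isFloquetDecomposition_iff_isReducedSolution
    (f := fun k => F₀ k k) (hF₀.eq_add hT.out) (reducedFamily_conj hA n hε),
    show Matrix.diagonal (fun k => F₀ k k) = F₀ from hF₀.diagonal.diagonal_diag]

theorem exists_analyticFloquetDecomposition (hr₀ : 0 < r₀)
    (hA : IsAnalyticPeriodicFamily T r₀ A A₀ Ac c) (hF₀ : IsLeadingExponent T A₀ F₀ n) :
    ∃ (F : ℂ → Matrix (Fin N) (Fin N) ℂ) (P : ℂ → ℝ → Matrix (Fin N) (Fin N) ℂ)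
      (Fc : ℕ → Matrix (Fin N) (Fin N) ℂ) (Pc : ℕ → ℝ → Matrix (Fin N) (Fin N) ℂ),
      IsAnalyticFloquetDecomposition T A F P Fc Pc ∧ Fc 0 = F₀ := by
  set R := reducedSol (fun k => F₀ k k) hF₀.expWeight_ne_zero with hR
  set g := reducedConst (N := N) T (fun k => F₀ k k) with hg
  obtain ⟨h, h0, hd, he⟩ := exists_solution_quadratic R ((constMatrix T).comp g)
    (hasFPowerSeriesAt_reducedFamily hr₀ hA n).analyticAt (reducedFamily_zero hr₀ hA n)
  obtain ⟨r, hr, hball⟩ := Metric.eventually_nhds_iff.mp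
    (hd.and (he.and (Metric.ball_mem_nhds (0 : ℂ) hr₀)))
  have hball' : ∀ ε : ℂ, ‖ε‖ < r → DifferentiableAt ℂ h ε ∧ _ ∧ _ := fun ε hε =>
    hball (by simpa using hε)
  set F : ℂ → Matrix (Fin N) (Fin N) ℂ := fun ε => F₀ + g (h ε) with hF
  set P : ℂ → ℝ → Matrix (Fin N) (Fin N) ℂ :=
    fun ε t => foldingMatrix T n t * evalMatrix T t (1 + R (h ε)) with hP
  have hFd : DifferentiableOn ℂ F (Metric.ball 0 r) := fun ε hε =>
    ((g.differentiableAt.comp ε (hball' ε (by simpa using hε)).1).const_add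
      F₀).differentiableWithinAt
  have hPd : ∀ t, DifferentiableOn ℂ (fun ε => P ε t) (Metric.ball 0 r) := fun t ε hε =>
    (((evalMatrix T t).differentiableAt.comp ε ((R.differentiableAt.comp ε
      (hball' ε (by simpa using hε)).1).const_add 1)).const_mul
        (foldingMatrix T n t)).differentiableWithinAt
  refine ⟨F, P, fun j => (j.factorial : ℂ)⁻¹ • iteratedDeriv j F 0,
    fun j t => (j.factorial : ℂ)⁻¹ • iteratedDeriv j (fun ε => P ε t) 0,
    ⟨r, hr, fun ε hε => ⟨?_, hasSum_pow_smul_taylor hFd hε,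
      fun t => hasSum_pow_smul_taylor (hPd t) hε⟩⟩, by simp [hF, h0]⟩
  obtain ⟨-, heq, hr0⟩ := hball' ε hε
  refine (isFloquetDecomposition_iff_reduced hA hF₀ (by simpa using hr0)).mpr ?_
  -- For Q = 1 + R h and G = g h, the quadratic equation says precisely that the source is h.
  have e : reducedFamily hA n ε * (1 + R (h ε)) - (1 + R (h ε) - 1) * constMatrix T (g (h ε)) =
      h ε := by
    rw [add_sub_cancel_left]; exact heq.symm
  rw [e, add_sub_cancel_left]
  exact ⟨rfl, rfl⟩

/-- D is invertible with periodic inverse, the folding numbers being integers. -/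
theorem exists_foldingMatrix_mul_eq {P : ℝ → Matrix (Fin N) (Fin N) ℂ}
    (hP : Function.Periodic P T) (hc : ∀ k l, Continuous fun t => P t k l) (n : Fin N → ℤ) :
    ∃ Q : Matrix (Fin N) (Fin N) C(AddCircle T, ℂ),
      ∀ t, P t = foldingMatrix T n t * evalMatrix T t Q := by
  refine ⟨Matrix.of fun k l => circleExp T (-n k) *
    circleLift (fun t => P t k l) (hc k l) (fun t => by simp only [hP t]), fun t => ?_⟩
  ext k l
  rw [foldingMatrix_mul_apply, evalMatrix_apply]
  change P t k l = exp (2 * Real.pi * I / T * n k * t) *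
    (circleExp T (-n k) (t : AddCircle T) * P t k l)
  rw [circleExp_coe, ← mul_assoc, ← Complex.exp_add]
  simp

/-- First order coefficients of an analytic Floquet decomposition, in terms of the solution
operators of the linearised problem. -/
theorem first_order_eq (hr₀ : 0 < r₀)
    (hA : IsAnalyticPeriodicFamily T r₀ A A₀ Ac c) (hF₀ : IsLeadingExponent T A₀ F₀ n)
    {F : ℂ → Matrix (Fin N) (Fin N) ℂ} {P : ℂ → ℝ → Matrix (Fin N) (Fin N) ℂ}
    {Fc : ℕ → Matrix (Fin N) (Fin N) ℂ} {Pc : ℕ → ℝ → Matrix (Fin N) (Fin N) ℂ}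
    (hFP : IsAnalyticFloquetDecomposition T A F P Fc Pc) (hFc : Fc 0 = F₀) :
    Fc 1 = reducedConst T (fun k => F₀ k k) (reducedCoeff T n c 1) ∧
    ∀ t, Pc 1 t = foldingMatrix T n t * evalMatrix T t
      (reducedSol (fun k => F₀ k k) hF₀.expWeight_ne_zero (reducedCoeff T n c 1)) := by
  obtain ⟨r, hr, hdec⟩ := hFP
  set R := reducedSol (fun k => F₀ k k) hF₀.expWeight_ne_zero with hR
  set g := reducedConst (N := N) T (fun k => F₀ k k) with hg
  have hFps := hasFPowerSeriesAt_of_tendsto_partialSum hr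
    fun ε hε => (hdec ε hε).2.1.tendsto_sum_nat
  have hPps := fun t => hasFPowerSeriesAt_of_tendsto_partialSum hr
    fun ε hε => ((hdec ε hε).2.2 t).tendsto_sum_nat
  have hFd : HasDerivAt F (Fc 1) 0 := hFps.hasDerivAt_mkPiRing
  have hPd : ∀ t, HasDerivAt (fun ε => P ε t) (Pc 1 t) 0 := fun t => (hPps t).hasDerivAt_mkPiRing
  have hF0 : F 0 = F₀ := by
    rw [← hFps.coeff_zero 0, ← hFc]; simp
  have hex : ∀ ε : ℂ, ‖ε‖ < r → ∃ Q : Matrix (Fin N) (Fin N) C(AddCircle T, ℂ),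
      ∀ t, P ε t = foldingMatrix T n t * evalMatrix T t Q := fun ε hε => by
    obtain ⟨hper, hfund⟩ := (hdec ε hε).1
    refine exists_foldingMatrix_mul_eq hper (fun k l => ?_) n
    exact continuous_iff_continuousAt.mpr fun t =>
      ((isFundamentalSolution_mul_exp_iff.mp hfund).2 t k l).continuousAt
  -- Q is chosen separately for each ε; no regularity of Q in ε is available or needed, since the
  -- series for P converges only pointwise in t.
  choose! Q hQ using hex
  set G : ℂ → Matrix (Fin N) (Fin N) ℂ := fun ε => F ε - F₀ with hG
  set h : ℂ → Matrix (Fin N) (Fin N) C(AddCircle T, ℂ) := fun ε =>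
    reducedFamily hA n ε * Q ε - (Q ε - 1) * constMatrix T (G ε) with hh
  have hsol : ∀ᶠ ε in 𝓝 (0 : ℂ), ‖ε‖ < r ∧ G ε = g (h ε) ∧ Q ε - 1 = R (h ε) := by
    filter_upwards [Metric.ball_mem_nhds (0 : ℂ) hr, Metric.ball_mem_nhds (0 : ℂ) hr₀] with ε h1 h2
    have h1' : ‖ε‖ < r := by simpa using h1
    refine ⟨h1', (isFloquetDecomposition_iff_reduced hA hF₀ (by simpa using h2)).mp ?_⟩
    have h3 := (hdec ε h1').1
    rwa [show P ε = fun t => foldingMatrix T n t * evalMatrix T t (Q ε) from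
      funext (hQ ε h1'), show F ε = F₀ + G ε by simp [hG]] at h3
  have hG0 : constMatrix T (G 0) = 0 := by simp [hG, hF0]
  -- Continuity of F at 0 is the regularity in ε that the first order estimate requires of the given
  -- decomposition.
  have hGt : Tendsto (fun ε => constMatrix T (G ε)) (𝓝 0) (𝓝 0) := by
    have : ContinuousAt (fun ε => constMatrix T (G ε)) 0 :=
      (constMatrix T).continuous.continuousAt.comp (hFd.continuousAt.sub continuousAt_const)
    simpa [ContinuousAt, hG0] using this
  obtain ⟨h0, hhd⟩ := hasDerivAt_solution_quadratic R
    (hasFPowerSeriesAt_reducedFamily hr₀ hA n).hasDerivAt_mkPiRing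
    (reducedFamily_zero hr₀ hA n) hGt hG0 (h := h) (by
      filter_upwards [hsol] with ε hε
      have e : Q ε = 1 + R (h ε) := by rw [← hε.2.2, add_sub_cancel]
      exact congrArg₂ (fun X Y => reducedFamily hA n ε * X - Y * constMatrix T (G ε)) e hε.2.2)
  refine ⟨?_, fun t => ?_⟩
  · have h1 : HasDerivAt (fun ε => F₀ + g (h ε)) (g (reducedCoeff T n c 1)) 0 :=
      (g.hasFDerivAt.comp_hasDerivAt 0 hhd).const_add F₀
    refine hFd.unique (h1.congr_of_eventuallyEq ?_)
    filter_upwards [hsol] with ε hε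
    rw [← hε.2.1]; simp [hG]
  · have h1 : HasDerivAt (fun ε => foldingMatrix T n t * evalMatrix T t (1 + R (h ε)))
        (foldingMatrix T n t * evalMatrix T t (R (reducedCoeff T n c 1))) 0 :=
      ((evalMatrix T t).hasFDerivAt.comp_hasDerivAt 0
        ((R.hasFDerivAt.comp_hasDerivAt 0 hhd).const_add 1)).const_mul (foldingMatrix T n t)
    refine (hPd t).unique (h1.congr_of_eventuallyEq ?_)
    filter_upwards [hsol] with ε hε
    rw [hQ ε hε.1 t, ← hε.2.2, add_sub_cancel]

end Family

end

/-! ### Explicit Fourier formulas. -/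

noncomputable section
open Filter Topology MeasureTheory intervalIntegral Complex
section FirstOrder

variable {N : ℕ} {T : ℝ} [hT : Fact (0 < T)] {A₀ F₀ : Matrix (Fin N) (Fin N) ℂ} {n : Fin N → ℤ}
  {c : ℕ → ℤ →₀ Matrix (Fin N) (Fin N) ℂ}

theorem reducedCoeff_one_apply (k l : Fin N) : reducedCoeff T n c 1 k l =
    ∑ m ∈ (c 1).support, c 1 m k l • circleExp T (m + n l - n k) := by
  simp [reducedCoeff, Finsupp.sum]

theorem reducedConst_reducedCoeff (hF₀ : IsLeadingExponent T A₀ F₀ n) (k l : Fin N) :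
    reducedConst T (fun k => F₀ k k) (reducedCoeff T n c 1) k l =
      ∑ m ∈ (c 1).support, c 1 m k l * if m + n l - n k = 0 then 1 else
        -(F₀ k k - F₀ l l) /
          (2 * Real.pi * I / T * ((m + n l - n k : ℤ) : ℂ) - (F₀ k k - F₀ l l)) := by
  rw [reducedConst, entrywiseCLM_apply, reducedCoeff_one_apply, map_sum]
  refine Finset.sum_congr rfl fun m _ => ?_
  rw [map_smul, (periodic_circleExp (hF₀.expWeight_ne_zero k l) (hF₀.nonresonant hT.out k l) _).1,
    smul_eq_mul]

theorem reducedSol_reducedCoeff (hF₀ : IsLeadingExponent T A₀ F₀ n) (t : ℝ) (k l : Fin N) :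
    evalMatrix T t (reducedSol (fun k => F₀ k k) hF₀.expWeight_ne_zero (reducedCoeff T n c 1)) k l =
      ∑ m ∈ (c 1).support, c 1 m k l * if m + n l - n k = 0 then 0 else
        (exp (2 * Real.pi * I / T * ((m + n l - n k : ℤ) : ℂ) * t) - 1) /
          (2 * Real.pi * I / T * ((m + n l - n k : ℤ) : ℂ) - (F₀ k k - F₀ l l)) := by
  rw [evalMatrix_apply, reducedSol, entrywiseCLM_apply, reducedCoeff_one_apply, map_sum,
    ContinuousMap.sum_apply]
  refine Finset.sum_congr rfl fun m _ => ?_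
  rw [map_smul, ContinuousMap.smul_apply,
    (periodic_circleExp (hF₀.expWeight_ne_zero k l) (hF₀.nonresonant hT.out k l) _).2, smul_eq_mul]

/-- Here λ = 0, so g is the mean and only the mode shifted to frequency zero survives. -/
theorem reducedConst_resonant (hF₀ : IsLeadingExponent T A₀ F₀ n) {k l : Fin N}
    (h : F₀ k k = F₀ l l) :
    reducedConst T (fun k => F₀ k k) (reducedCoeff T n c 1) k l = c 1 (n k - n l) k l := by
  rw [reducedConst_reducedCoeff hF₀, h, sub_self]
  rw [Finset.sum_eq_single (n k - n l)]
  · simp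
  · intro m _ hm
    rw [if_neg (by omega)]
    simp
  · intro hm
    rw [Finsupp.notMem_support_iff.mp hm]
    simp

theorem reducedConst_nonresonant (hF₀ : IsLeadingExponent T A₀ F₀ n) {k l : Fin N}
    (h : F₀ k k ≠ F₀ l l) :
    reducedConst T (fun k => F₀ k k) (reducedCoeff T n c 1) k l = (F₀ l l - F₀ k k) *
      ∑ᶠ m : ℤ, c 1 m k l / (2 * Real.pi * I / T * m + A₀ l l - A₀ k k) := by
  rw [reducedConst_reducedCoeff hF₀, finsum_eq_sum_of_support_subset (s := (c 1).support),
    Finset.mul_sum]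
  · refine Finset.sum_congr rfl fun m _ => ?_
    have hd : 2 * Real.pi * I / T * (m : ℂ) + A₀ l l - A₀ k k =
        2 * Real.pi * I / T * ((m + n l - n k : ℤ) : ℂ) - (F₀ k k - F₀ l l) := by
      rw [hF₀.eq_add hT.out k, hF₀.eq_add hT.out l]
      push_cast
      ring
    rw [hd]
    -- For the mode shifted to zero the denominator is -λ, so the general quotient equals 1 and
    -- needs no separate case in the statement.
    split_ifs with h0
    · have hs : F₀ k k - F₀ l l ≠ 0 := sub_ne_zero.mpr h
      rw [h0, Int.cast_zero, mul_zero, zero_sub]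
      field_simp
      ring
    · ring
  · intro m hm
    by_contra hc
    refine hm ?_
    rw [Finset.mem_coe, Finsupp.notMem_support_iff] at hc
    simp [hc]

/-- Each mode contributes a multiple of exp(μt) - 1. After multiplication by exp(2πi n_k t/T), all
the -1 terms collect in the mode n_k, which explains the inner sum. -/
theorem foldingMatrix_mul_reducedSol (hF₀ : IsLeadingExponent T A₀ F₀ n) (t : ℝ) (k l : Fin N) :
    (foldingMatrix T n t * evalMatrix T t
      (reducedSol (fun k => F₀ k k) hF₀.expWeight_ne_zero (reducedCoeff T n c 1))) k l =
    ∑ᶠ m : ℤ, exp (2 * Real.pi * I / T * m * t) *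
      (if m ≠ n k then
        c 1 (m - n l) k l / (2 * Real.pi * I / T * m - A₀ k k + F₀ l l)
      else
        -∑ᶠ (m' : ℤ) (_ : m' ≠ n k),
          c 1 (m' - n l) k l / (2 * Real.pi * I / T * m' - A₀ k k + F₀ l l)) := by
  classical
  set u : ℤ → ℂ := fun m => if m ≠ n k then
    c 1 (m - n l) k l / (2 * Real.pi * I / T * m - A₀ k k + F₀ l l) else 0 with hu
  set E : ℤ → ℂ := fun m => exp (2 * Real.pi * I / T * m * t) with hE
  -- Outer frequencies are those of A₁ shifted by n_l.
  set s : Finset ℤ := (c 1).support.map (addRightEmbedding (n l)) with hs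
  have hu0 : ∀ m, m ∉ s → u m = 0 := fun m hm => by
    have : m - n l ∉ (c 1).support := fun h =>
      hm (Finset.mem_map.mpr ⟨m - n l, h, by simp⟩)
    simp [hu, Finsupp.notMem_support_iff.mp this]
  have hinner : (∑ᶠ (m' : ℤ) (_ : m' ≠ n k),
      c 1 (m' - n l) k l / (2 * Real.pi * I / T * m' - A₀ k k + F₀ l l)) = ∑ m ∈ s, u m := by
    rw [← finsum_eq_sum_of_support_subset (s := s) u
      fun m hm => by by_contra hc; exact hm (hu0 m hc)]
    refine finsum_congr fun m => ?_
    rw [finsum_eq_if]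
  -- The mode n_k is inserted because it may carry the correction even when it lies outside the
  -- shifted support.
  rw [hinner, finsum_eq_sum_of_support_subset (s := insert (n k) s)]
  · have hterm : ∀ m : ℤ, E m * (if m ≠ n k then
        c 1 (m - n l) k l / (2 * Real.pi * I / T * m - A₀ k k + F₀ l l) else -∑ m ∈ s, u m) =
        E m * u m + if m = n k then -(E (n k) * ∑ m ∈ s, u m) else 0 := fun m => by
      by_cases hm : m = n k <;> simp [hu, hm]
    rw [Finset.sum_congr rfl fun m _ => hterm m, Finset.sum_add_distrib, Finset.sum_ite_eq',
      if_pos (Finset.mem_insert_self _ _)]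
    rw [← Finset.sum_subset (Finset.subset_insert (n k) s)
      fun m _ hm => by rw [hu0 m hm, mul_zero], ← sub_eq_add_neg, Finset.mul_sum,
      ← Finset.sum_sub_distrib, hs, Finset.sum_map, foldingMatrix_mul_apply,
      reducedSol_reducedCoeff hF₀, Finset.mul_sum]
    refine Finset.sum_congr rfl fun m _ => ?_
    simp only [addRightEmbedding_apply, hu, hE, add_sub_cancel_right]
    by_cases h0 : m + n l - n k = 0
    · simp [show m + n l = n k by omega]
    · have hd : 2 * Real.pi * I / T * ((m + n l : ℤ) : ℂ) - A₀ k k + F₀ l l =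
          2 * Real.pi * I / T * ((m + n l - n k : ℤ) : ℂ) - (F₀ k k - F₀ l l) := by
        rw [hF₀.eq_add hT.out k]
        push_cast
        ring
      have he : exp (2 * Real.pi * I / T * ((m + n l : ℤ) : ℂ) * t) =
          exp (2 * Real.pi * I / T * n k * t) *
            exp (2 * Real.pi * I / T * ((m + n l - n k : ℤ) : ℂ) * t) := by
        rw [← Complex.exp_add]; push_cast; ring_nf
      rw [if_neg h0, if_pos (show m + n l ≠ n k by omega), hd, he]
      ring
  · intro m hm
    by_contra hc
    rw [Finset.mem_coe, Finset.mem_insert, not_or] at hc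
    refine hm ?_
    have := hu0 m hc.2
    simp only [hu, ne_eq, hc.1, not_false_iff, if_true] at this
    simp only [ne_eq, hc.1, not_false_iff, if_true, this, mul_zero]

theorem reducedConst_diag (k : Fin N) : reducedConst T (fun k => F₀ k k) (reducedCoeff T n c 1) k k =
    1 / T * ∫ t in (0 : ℝ)..T, finiteFourierSeries T (c 1) t k k := by
  rw [reducedConst, entrywiseCLM_apply, sub_self, periodicConst_apply]
  have h1 : expWeight T 0 = T := by simp [expWeight]
  rw [h1, one_div]
  congr 1
  refine intervalIntegral.integral_congr fun t _ => ?_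
  simp only [reducedCoeff_coe one_ne_zero, circleExp_coe]
  simp

end FirstOrder


end

theorem theorem3p2 {N : ℕ} (T r₀ : ℝ) (hT : 0 < T) (hr₀ : 0 < r₀)
    (A : ℂ → ℝ → Matrix (Fin N) (Fin N) ℂ) (A₀ : Matrix (Fin N) (Fin N) ℂ)
    (Ac : ℕ → ℝ → Matrix (Fin N) (Fin N) ℂ) (c : ℕ → ℤ →₀ Matrix (Fin N) (Fin N) ℂ)
    (hA : IsAnalyticPeriodicFamily T r₀ A A₀ Ac c)
    (F₀ : Matrix (Fin N) (Fin N) ℂ) (n : Fin N → ℤ) (hF₀ : IsLeadingExponent T A₀ F₀ n) :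
    (∃ (F : ℂ → Matrix (Fin N) (Fin N) ℂ) (P : ℂ → ℝ → Matrix (Fin N) (Fin N) ℂ)
        (Fc : ℕ → Matrix (Fin N) (Fin N) ℂ) (Pc : ℕ → ℝ → Matrix (Fin N) (Fin N) ℂ),
        IsAnalyticFloquetDecomposition T A F P Fc Pc ∧ Fc 0 = F₀) ∧
    ∀ (F : ℂ → Matrix (Fin N) (Fin N) ℂ) (P : ℂ → ℝ → Matrix (Fin N) (Fin N) ℂ)
      (Fc : ℕ → Matrix (Fin N) (Fin N) ℂ) (Pc : ℕ → ℝ → Matrix (Fin N) (Fin N) ℂ),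
      IsAnalyticFloquetDecomposition T A F P Fc Pc → Fc 0 = F₀ →
      (∀ k l : Fin N,
        (F₀ k k = F₀ l l → Fc 1 k l = c 1 (n k - n l) k l) ∧
        (F₀ k k ≠ F₀ l l →
          Fc 1 k l = (F₀ l l - F₀ k k) *
            ∑ᶠ m : ℤ, c 1 m k l / (2 * Real.pi * Complex.I / T * m + A₀ l l - A₀ k k))) ∧
      (∀ (t : ℝ) (k l : Fin N),
        Pc 1 t k l = ∑ᶠ m : ℤ, Complex.exp (2 * Real.pi * Complex.I / T * m * t) *
          (if m ≠ n k then
            c 1 (m - n l) k l / (2 * Real.pi * Complex.I / T * m - A₀ k k + F₀ l l)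
          else
            -∑ᶠ (m' : ℤ) (_ : m' ≠ n k),
              c 1 (m' - n l) k l / (2 * Real.pi * Complex.I / T * m' - A₀ k k + F₀ l l))) ∧
      (∀ k : Fin N, Fc 1 k k = c 1 0 k k ∧
        Fc 1 k k = 1 / T * ∫ t in (0 : ℝ)..T, Ac 1 t k k) := by
  have : Fact (0 < T) := ⟨hT⟩
  refine ⟨exists_analyticFloquetDecomposition hr₀ hA hF₀, fun F P Fc Pc hFP hFc => ?_⟩
  obtain ⟨hF1, hP1⟩ := first_order_eq hr₀ hA hF₀ hFP hFc
  refine ⟨fun k l => ⟨fun h => ?_, fun h => ?_⟩, fun t k l => ?_, fun k => ⟨?_, ?_⟩⟩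
  · rw [hF1, reducedConst_resonant hF₀ h]
  · rw [hF1, reducedConst_nonresonant hF₀ h]
  · rw [hP1, foldingMatrix_mul_reducedSol hF₀]
  · rw [hF1, reducedConst_resonant hF₀ rfl, sub_self]
  · rw [hF1, reducedConst_diag]
    simp only [hA.coeff_fourier 1 le_rfl]
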